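/- Let $\Omega\subset\mathbb R^3$ be a bounded Lipschitz domain that is simply connected and has connected boundary. Let $w:\overline\Omega\times\mathbb R^3\to\mathbb R$ be piecewise continuous in its first argument, with $w(x,\cdot)\in C^2(\mathbb R^3)$ for all $x\in\overline\Omega$, and suppose that there are constants $C$ and $\gamma,L>0$ such that $|w(x,0)|+|\partial_b w(x,0)|\le C$ and $\gamma|\xi|^2\le\langle\partial_{bb}w(x,\eta)\xi,\xi\rangle\le L|\xi|^2$ for all $x\in\overline\Omega$ and $\xi,\eta\in\mathbb R^3$. Let $\mathcal T_h$ be a finite, geometrically conforming, shape-regular partition of $\Omega$ into tetrahedra, and let $\phi_T$ be the affine map from the reference tetrahedron $\hat T$ (with vertices $0,e_1,e_2,e_3$) to $T\in\mathcal T_h$. Let $\hat x_1,\dots,\hat x_\ell\in\hat T$ and $\hat w_1,\dots,\hat w_\ell>0$ be a quadrature rule, put $x_{T,j}=\phi_T(\hat x_j)$ and $$\langle u,v\rangle_h=\sum_{T\in\mathcal T_h}\sum_{j=1}^{\ell}u(x_{T,j})\cdot v(x_{T,j})\,\hat w_j\,|T|,$$ where functions that are only piecewise continuous on the mesh are evaluated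 from within $T$. Let $k\ge 0$, and assume that $\langle u,v\rangle_h=\int_\Omega u\cdot v\,dx$ for all $u,v\in P_k(\mathcal T_h)^3$, the piecewise polynomial vector fields of degree at most $k$. Let $W_h=\mathcal N_k(\mathcal T_h)\cap H_0(\operatorname{curl};\Omega)$, where $\mathcal N_k(\mathcal T_h)$ consists of the fields that on every $T$ lie in the first-kind Nédélec space $P_k^3+x\times\tilde P_k^3$, with $\tilde P_k$ the homogeneous polynomials of degree $k$. Let $S_h=P_{k+1}(\mathcal T_h)\cap H_0^1(\Omega)$, and let $V_h$ be a subspace of $W_h$ with $W_h=\nabla S_h\oplus V_h$ and $\|v_h\|_{H(\operatorname{curl})}\le C_*\|\operatorname{curl}v_h\|_{L^2(\Omega)}$ for some $C_*>0$ and all $v_h\in V_h$. Let $h_s\in H(\operatorname{curl};\Omega)\cap H^2(\mathcal T_h)^3$. Then the minimization problem $$\min_{a_h\in V_h}\ \langle w(\operatorname{curl}a_h),1\rangle_h-\langle h_s,\operatorname{curl}a_h\rangle_h$$ has a unique solution $a_h\in V_h$. Moreover, an element $a_h\in V_h$ is this minimizer if and only if $$\langle\partial_b w(\operatorname{curl}a_h),\operatorname{curl}v_h\rangle_h=\langle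 h_s,\operatorname{curl}v_h\rangle_h\qquad\text{for all }v_h\in V_h.$$ -/

import Mathlib

open MeasureTheory Set
open scoped ContDiff NNReal

noncomputable section

namespace Magnetostatics

/-- Euclidean space of dimension three. -/
abbrev E3 : Type := EuclideanSpace ℝ (Fin 3)

/-! ### Differential operators on smooth functions -/

/-- The partial derivative `∂ᵢ f`. -/
def pd (i : Fin 3) (f : E3 → ℝ) (x : E3) : ℝ :=
  fderiv ℝ f x (EuclideanSpace.single i 1)

/-- The classical curl of a smooth vector field. -/
def curl (φ : E3 → E3) (x : E3) : E3 :=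
  !₂[pd 1 (fun y => φ y 2) x - pd 2 (fun y => φ y 1) x,
     pd 2 (fun y => φ y 0) x - pd 0 (fun y => φ y 2) x,
     pd 0 (fun y => φ y 1) x - pd 1 (fun y => φ y 0) x]

/-- The classical divergence of a smooth vector field. -/
def divergence (φ : E3 → E3) (x : E3) : ℝ :=
  ∑ i, pd i (fun y => φ y i) x

/-! ### Sobolev spaces -/

/-- A smooth, compactly supported function on the whole space. -/
def IsTest {F : Type*} [NormedAddCommGroup F] [NormedSpace ℝ F] (φ : E3 → F) : Prop :=
  ContDiff ℝ ∞ φ ∧ HasCompactSupport φ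

/-- `g` is the weak partial derivative `∂ᵢ f` on the open set `U`. -/
def IsWeakPd (U : Set E3) (i : Fin 3) (f g : E3 → ℝ) : Prop :=
  ∀ φ : E3 → ℝ, IsTest φ → tsupport φ ⊆ U →
    ∫ x in U, f x * pd i φ x = -∫ x in U, g x * φ x

/-- `f ∈ Hᵐ(U)`: weak derivatives of order at most `m` are square integrable. -/
def MemH (U : Set E3) : ℕ → (E3 → ℝ) → Prop
  | 0, f => MemLp f 2 (volume.restrict U)
  | m + 1, f => MemLp f 2 (volume.restrict U) ∧
      ∀ i : Fin 3, ∃ g : E3 → ℝ, IsWeakPd U i f g ∧ MemH U m g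

/-- `g` is the weak curl of `u` on the open set `U`. -/
def IsWeakCurl (U : Set E3) (u g : E3 → E3) : Prop :=
  ∀ φ : E3 → E3, IsTest φ → tsupport φ ⊆ U →
    ∫ x in U, inner ℝ (u x) (curl φ x) = ∫ x in U, inner ℝ (g x) (φ x)

/-- `u ∈ H(curl; U)`. -/
def MemHCurl (U : Set E3) (u : E3 → E3) : Prop :=
  MemLp u 2 (volume.restrict U) ∧
    ∃ g : E3 → E3, MemLp g 2 (volume.restrict U) ∧ IsWeakCurl U u g

lemma IsTest.continuous_pd {φ : E3 → ℝ} (h : IsTest φ) (i : Fin 3) : Continuous (pd i φ) :=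
  (h.1.continuous_fderiv (by simp)).clm_apply continuous_const

lemma IsTest.hasCompactSupport_pd {φ : E3 → ℝ} (h : IsTest φ) (i : Fin 3) :
    HasCompactSupport (pd i φ) :=
  h.2.fderiv_apply ℝ (EuclideanSpace.single i 1)

lemma IsTest.comp {φ : E3 → E3} (h : IsTest φ) (i : Fin 3) : IsTest (fun x => φ x i) := by
  refine ⟨?_, ?_⟩
  · exact (EuclideanSpace.proj (𝕜 := ℝ) (ι := Fin 3) i).contDiff.comp h.1
  · exact h.2.comp_left (g := fun y : E3 => y i) rfl

lemma IsTest.memLp {F : Type*} [NormedAddCommGroup F] [NormedSpace ℝ F] {φ : E3 → F}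
    (h : IsTest φ) (U : Set E3) : MemLp φ 2 (volume.restrict U) :=
  (h.1.continuous.memLp_of_hasCompactSupport h.2).restrict U

lemma IsTest.memLp_pd {φ : E3 → E3} (h : IsTest φ) (U : Set E3) (i j : Fin 3) :
    MemLp (pd i (fun y => φ y j)) 2 (volume.restrict U) :=
  (((h.comp j).continuous_pd i).memLp_of_hasCompactSupport
    ((h.comp j).hasCompactSupport_pd i)).restrict U

lemma IsTest.memLp_divergence {φ : E3 → E3} (h : IsTest φ) (U : Set E3) :
    MemLp (divergence φ) 2 (volume.restrict U) :=
  memLp_finsetSum _ (fun i _ => h.memLp_pd U i i)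

lemma IsTest.memLp_curl {φ : E3 → E3} (h : IsTest φ) (U : Set E3) :
    MemLp (curl φ) 2 (volume.restrict U) := by
  refine MemLp.of_eval_piLp fun i => ?_
  fin_cases i
  · exact (h.memLp_pd U 1 2).sub (h.memLp_pd U 2 1)
  · exact (h.memLp_pd U 2 0).sub (h.memLp_pd U 0 2)
  · exact (h.memLp_pd U 0 1).sub (h.memLp_pd U 1 0)

lemma integrable_inner_of_memLp {U : Set E3} {u v : E3 → E3}
    (hu : MemLp u 2 (volume.restrict U)) (hv : MemLp v 2 (volume.restrict U)) :
    Integrable (fun x => inner ℝ (u x) (v x)) (volume.restrict U) :=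
  memLp_one_iff_integrable.1 ((innerSL ℝ (E := E3)).memLp_of_bilin 1 hu hv)

/-- `H₀(curl; Ω)`, the fields in `H(curl; Ω)` with vanishing tangential trace. The trace is
understood through Green's formula
`∫_Ω u · curl φ = ∫_Ω curl u · φ - ∫_∂Ω (n × u) · φ`: test fields `φ` supported in `Ω` express
that `g` is the weak curl of `u`, and general test fields that the boundary term vanishes. -/
def HCurl0 (Ω : Set E3) : Submodule ℝ (E3 → E3) where
  carrier := {u | MemLp u 2 (volume.restrict Ω) ∧
    ∃ g : E3 → E3, MemLp g 2 (volume.restrict Ω) ∧ IsWeakCurl Ω u g ∧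
      ∀ φ : E3 → E3, IsTest φ →
        ∫ x in Ω, inner ℝ (u x) (curl φ x) = ∫ x in Ω, inner ℝ (g x) (φ x)}
  zero_mem' := ⟨MemLp.zero, 0, MemLp.zero, by intro φ _ _; simp, by intro φ _; simp⟩
  add_mem' := by
    rintro u v ⟨hu, g, hg, -, hug⟩ ⟨hv, k, hk, -, hvk⟩
    have key : ∀ φ : E3 → E3, IsTest φ →
        ∫ x in Ω, inner ℝ ((u + v) x) (curl φ x) = ∫ x in Ω, inner ℝ ((g + k) x) (φ x) := by
      intro φ hφ
      simp only [Pi.add_apply, inner_add_left]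
      rw [integral_add (integrable_inner_of_memLp hu (hφ.memLp_curl Ω))
          (integrable_inner_of_memLp hv (hφ.memLp_curl Ω)),
        integral_add (integrable_inner_of_memLp hg (hφ.memLp Ω)) (integrable_inner_of_memLp hk (hφ.memLp Ω)),
        hug φ hφ, hvk φ hφ]
    exact ⟨hu.add hv, g + k, hg.add hk, fun φ hφ _ => key φ hφ, key⟩
  smul_mem' := by
    rintro c u ⟨hu, g, hg, -, hug⟩
    have key : ∀ φ : E3 → E3, IsTest φ →
        ∫ x in Ω, inner ℝ ((c • u) x) (curl φ x) = ∫ x in Ω, inner ℝ ((c • g) x) (φ x) := by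
      intro φ hφ
      simp only [Pi.smul_apply, real_inner_smul_left]
      rw [integral_const_mul, integral_const_mul, hug φ hφ]
    exact ⟨hu.const_smul c, c • g, hg.const_smul c, fun φ hφ _ => key φ hφ, key⟩

/-- `H₀¹(Ω)`, the functions in `H¹(Ω)` with vanishing trace. The trace is understood through
`∫_Ω f div φ = -∫_Ω ∇f · φ + ∫_∂Ω f (φ · n)`: test fields `φ` supported in `Ω` express that `g`
is the weak gradient of `f`, and general test fields that the boundary term vanishes. -/
def H10 (Ω : Set E3) : Submodule ℝ (E3 → ℝ) where
  carrier := {f | MemLp f 2 (volume.restrict Ω) ∧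
    ∃ g : E3 → E3, MemLp g 2 (volume.restrict Ω) ∧
      ∀ φ : E3 → E3, IsTest φ →
        ∫ x in Ω, f x * divergence φ x = -∫ x in Ω, inner ℝ (g x) (φ x)}
  zero_mem' := ⟨MemLp.zero, 0, MemLp.zero, by intro φ _; simp⟩
  add_mem' := by
    rintro u v ⟨hu, g, hg, hug⟩ ⟨hv, k, hk, hvk⟩
    refine ⟨hu.add hv, g + k, hg.add hk, fun φ hφ => ?_⟩
    simp only [Pi.add_apply, inner_add_left, add_mul]
    have h1 : Integrable (fun x => u x * divergence φ x) (volume.restrict Ω) :=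
      hu.integrable_mul (hφ.memLp_divergence Ω)
    have h2 : Integrable (fun x => v x * divergence φ x) (volume.restrict Ω) :=
      hv.integrable_mul (hφ.memLp_divergence Ω)
    rw [integral_add h1 h2, integral_add (integrable_inner_of_memLp hg (hφ.memLp Ω)) (integrable_inner_of_memLp hk (hφ.memLp Ω)),
      hug φ hφ, hvk φ hφ]
    ring
  smul_mem' := by
    rintro c u ⟨hu, g, hg, hug⟩
    refine ⟨hu.const_smul c, c • g, hg.const_smul c, fun φ hφ => ?_⟩
    simp only [Pi.smul_apply, real_inner_smul_left, smul_eq_mul, mul_assoc]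
    rw [integral_const_mul, integral_const_mul, hug φ hφ]
    ring

/-! ### The domain and the energy density -/

/-- Near each boundary point, after a rigid motion, `Ω` is the set above the graph of a Lipschitz
function. -/
def HasLipschitzBoundary (Ω : Set E3) : Prop :=
  ∀ x ∈ frontier Ω, ∃ (R : E3 ≃ₗᵢ[ℝ] E3) (K : ℝ≥0) (f : EuclideanSpace ℝ (Fin 2) → ℝ) (r : ℝ),
    0 < r ∧ LipschitzWith K f ∧
      ∀ y ∈ Metric.ball x r, (y ∈ Ω ↔ f !₂[R y 0, R y 1] < R y 2)

/-- A bounded Lipschitz domain of trivial topology. -/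
structure IsAdmissibleDomain (Ω : Set E3) : Prop where
  isOpen : IsOpen Ω
  bounded : Bornology.IsBounded Ω
  lipschitz : HasLipschitzBoundary Ω
  simplyConnected : SimplyConnectedSpace Ω
  connected_frontier : IsConnected (frontier Ω)

/-- `w` is piecewise continuous in its first argument: there are finitely many pairwise disjoint
open pieces with null boundaries, whose closures cover `closure Ω`, and on each piece every
`w(·, η)` extends continuously to the closure of the piece. -/
def PiecewiseContinuousFst (Ω : Set E3) (w : E3 → E3 → ℝ) : Prop :=
  ∃ (n : ℕ) (U : Fin n → Set E3),
    (∀ i, IsOpen (U i) ∧ U i ⊆ Ω ∧ volume (frontier (U i)) = 0) ∧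
    Pairwise (fun i j => Disjoint (U i) (U j)) ∧
    closure Ω = ⋃ i, closure (U i) ∧
    ∀ i η, ∃ g : E3 → ℝ, ContinuousOn g (closure (U i)) ∧ EqOn (fun x => w x η) g (U i)

/-- The conditions on the magnetic energy density `w : closure Ω × ℝ³ → ℝ`
(values of `w x` at points `x` outside `closure Ω` play no role). -/
structure IsEnergyDensity (Ω : Set E3) (w : E3 → E3 → ℝ) : Prop where
  piecewise : PiecewiseContinuousFst Ω w
  contDiff : ∀ x ∈ closure Ω, ContDiff ℝ 2 (w x)
  bounded : ∃ C : ℝ, ∀ x ∈ closure Ω, |w x 0| + ‖gradient (w x) 0‖ ≤ C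
  elliptic : ∃ γ L : ℝ, 0 < γ ∧ 0 < L ∧ ∀ x ∈ closure Ω, ∀ ξ η : E3,
    γ * ‖ξ‖ ^ 2 ≤ fderiv ℝ (fderiv ℝ (w x)) η ξ ξ ∧
      fderiv ℝ (fderiv ℝ (w x)) η ξ ξ ≤ L * ‖ξ‖ ^ 2

/-! ### Meshes and quadrature -/

/-- A finite, geometrically conforming tetrahedral partition of `Ω`. The vertices of each
tetrahedron are numbered, which fixes the affine map from the reference tetrahedron. -/
structure TetMesh (ι : Type*) (Ω : Set E3) where
  /-- The vertices of the elements. -/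
  vert : ι → Fin 4 → E3
  affineIndependent : ∀ T, AffineIndependent ℝ (vert T)
  injective : Function.Injective fun T => range (vert T)
  cover : ⋃ T, convexHull ℝ (range (vert T)) = closure Ω
  conforming : ∀ T T', convexHull ℝ (range (vert T)) ∩ convexHull ℝ (range (vert T')) =
    convexHull ℝ (range (vert T) ∩ range (vert T'))

/-- A quadrature rule on the reference tetrahedron with positive weights, normalised so that it
is multiplied by the volume of the element. -/
structure QuadRule (ℓ : ℕ) where
  /-- The integration points. -/
  node : Fin ℓ → E3
  /-- The weights. -/
  weight : Fin ℓ → ℝ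
  node_mem : ∀ j, (∀ i, 0 ≤ node j i) ∧ ∑ i, node j i ≤ 1
  weight_pos : ∀ j, 0 < weight j

/-- Scalar polynomials in three variables. -/
abbrev SPoly : Type := MvPolynomial (Fin 3) ℝ

/-- Vector-valued polynomials in three variables. -/
abbrev VPoly : Type := Fin 3 → SPoly

/-- The polynomial `p` as a function. -/
def SPoly.toFun (p : SPoly) (x : E3) : ℝ := MvPolynomial.eval (fun i => x i) p

/-- The vector-valued polynomial `p` as a vector field. -/
def VPoly.toFun (p : VPoly) (x : E3) : E3 := WithLp.toLp 2 fun i => SPoly.toFun (p i) x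

/-- The curl of a polynomial vector field. -/
def VPoly.curl (p : VPoly) : VPoly :=
  ![MvPolynomial.pderiv 1 (p 2) - MvPolynomial.pderiv 2 (p 1),
    MvPolynomial.pderiv 2 (p 0) - MvPolynomial.pderiv 0 (p 2),
    MvPolynomial.pderiv 0 (p 1) - MvPolynomial.pderiv 1 (p 0)]

/-- The space `P_k³` of vector-valued polynomials of degree at most `k`. -/
def polyVec (k : ℕ) : Submodule ℝ VPoly :=
  Submodule.pi univ fun _ => MvPolynomial.restrictTotalDegree (Fin 3) ℝ k

/-- The local Nedelec space of the first kind `P_k³ + x × P̃_k³`, with `P̃_k` the homogeneous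
polynomials of degree `k` (so `k = 0` is the lowest order). -/
def nedelecLocal (k : ℕ) : Submodule ℝ VPoly :=
  polyVec k ⊔
    (Submodule.pi univ fun _ => MvPolynomial.homogeneousSubmodule (Fin 3) ℝ k).map
      ((crossProduct (R := SPoly) fun i => MvPolynomial.X i).restrictScalars ℝ)

/-- The elementwise gradient of a piecewise polynomial. -/
def brokenGrad (ι : Type*) : (ι → SPoly) →ₗ[ℝ] (ι → VPoly) :=
  LinearMap.pi fun T => LinearMap.pi fun i =>
    (MvPolynomial.pderiv (R := ℝ) i).toLinearMap ∘ₗ LinearMap.proj T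

namespace TetMesh

variable {ι : Type*} {Ω : Set E3}

/-- The closed tetrahedron with index `T`. -/
def elem (M : TetMesh ι Ω) (T : ι) : Set E3 := convexHull ℝ (range (M.vert T))

/-- The affine map `φ_T` from the reference tetrahedron with vertices `0, e₁, e₂, e₃`. -/
def refMap (M : TetMesh ι Ω) (T : ι) (x : E3) : E3 :=
  M.vert T 0 + ∑ i : Fin 3, x i • (M.vert T i.succ - M.vert T 0)

/-- Each element contains a ball of radius `ρ` with `diam T ≤ σ ρ`. -/
def ShapeRegular (M : TetMesh ι Ω) (σ : ℝ) : Prop :=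
  ∀ T, ∃ (c : E3) (ρ : ℝ), 0 < ρ ∧ Metric.closedBall c ρ ⊆ M.elem T ∧
    Metric.diam (M.elem T) ≤ σ * ρ

/-- `⟨f, g⟩_h` for functions that are given element by element; on the element `T`, the values
are those of `f T` and `g T`. -/
def quadInner [Fintype ι] {F : Type*} [NormedAddCommGroup F] [InnerProductSpace ℝ F]
    (M : TetMesh ι Ω) {ℓ : ℕ} (Q : QuadRule ℓ) (f g : ι → E3 → F) : ℝ :=
  ∑ T, ∑ j, inner ℝ (f T (M.refMap T (Q.node j))) (g T (M.refMap T (Q.node j))) *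
    Q.weight j * volume.real (M.elem T)

/-- The function on `Ω` that is given by `f T` in the interior of each element `T`; it is set to
zero on the element boundaries, which are null sets. -/
def glue [Fintype ι] {F : Type*} [AddCommMonoid F] (M : TetMesh ι Ω) (f : ι → E3 → F)
    (x : E3) : F :=
  ∑ T, (interior (M.elem T)).indicator (f T) x

/-- The function on `Ω` given by a piecewise polynomial. -/
def glueS [Fintype ι] (M : TetMesh ι Ω) : (ι → SPoly) →ₗ[ℝ] (E3 → ℝ) where
  toFun p := M.glue fun T => (p T).toFun
  map_add' p q := by
    funext x
    simp only [glue, Pi.add_apply, ← Finset.sum_add_distrib]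
    refine Finset.sum_congr rfl fun T _ => ?_
    by_cases hx : x ∈ interior (M.elem T) <;> simp [hx, SPoly.toFun]
  map_smul' c p := by
    funext x
    simp only [glue, Pi.smul_apply, Finset.smul_sum, RingHom.id_apply]
    refine Finset.sum_congr rfl fun T _ => ?_
    by_cases hx : x ∈ interior (M.elem T) <;> simp [hx, SPoly.toFun]

/-- The vector field on `Ω` given by a piecewise polynomial. -/
def glueV [Fintype ι] (M : TetMesh ι Ω) : (ι → VPoly) →ₗ[ℝ] (E3 → E3) where
  toFun p := M.glue fun T => (p T).toFun
  map_add' p q := by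
    funext x
    simp only [glue, Pi.add_apply, ← Finset.sum_add_distrib]
    refine Finset.sum_congr rfl fun T _ => ?_
    by_cases hx : x ∈ interior (M.elem T)
    · ext i; simp [hx, VPoly.toFun, SPoly.toFun]
    · simp [hx]
  map_smul' c p := by
    funext x
    simp only [glue, Pi.smul_apply, Finset.smul_sum, RingHom.id_apply]
    refine Finset.sum_congr rfl fun T _ => ?_
    by_cases hx : x ∈ interior (M.elem T)
    · ext i; simp [hx, VPoly.toFun, SPoly.toFun]
    · simp [hx]

/-- `‖u‖_{L²(Ω)}` for a piecewise polynomial vector field `u`. -/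
def l2Norm [Fintype ι] (M : TetMesh ι Ω) (u : ι → VPoly) : ℝ :=
  √(∫ x in Ω, ‖M.glueV u x‖ ^ 2)

/-- The elementwise curl of a piecewise polynomial vector field. For fields in `H(curl; Ω)` it is
the weak curl. -/
def brokenCurl (u : ι → VPoly) : ι → VPoly := fun T => (u T).curl

/-- The elementwise curl as a family of functions. -/
def curlFun (u : ι → VPoly) : ι → E3 → E3 := fun T => (brokenCurl u T).toFun

/-- `‖u‖_{H(curl)}` for a piecewise polynomial vector field `u` in `H(curl; Ω)`. -/
def hCurlNorm [Fintype ι] (M : TetMesh ι Ω) (u : ι → VPoly) : ℝ :=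
  √(M.l2Norm u ^ 2 + M.l2Norm (brokenCurl u) ^ 2)

/-- The quadrature rule is exact on products of piecewise polynomials:
`⟨u, v⟩_h = ⟨u, v⟩_Ω` for `u, v ∈ P_k(𝒯_h)³`. -/
def QuadExact [Fintype ι] (M : TetMesh ι Ω) {ℓ : ℕ} (Q : QuadRule ℓ) (k : ℕ) : Prop :=
  ∀ u v : ι → VPoly, (∀ T, u T ∈ polyVec k) → (∀ T, v T ∈ polyVec k) →
    M.quadInner Q (fun T => (u T).toFun) (fun T => (v T).toFun) =
      ∫ x in Ω, inner ℝ (M.glueV u x) (M.glueV v x)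

/-- The Nedelec space `W_h = 𝒩_k(𝒯_h) ∩ H₀(curl; Ω)`. -/
def nedelec [Fintype ι] (M : TetMesh ι Ω) (k : ℕ) : Submodule ℝ (ι → VPoly) :=
  (Submodule.pi univ fun _ => nedelecLocal k) ⊓ (HCurl0 Ω).comap M.glueV

/-- The space `S_h = P_{k+1}(𝒯_h) ∩ H₀¹(Ω)`. -/
def lagrange [Fintype ι] (M : TetMesh ι Ω) (k : ℕ) : Submodule ℝ (ι → SPoly) :=
  (Submodule.pi univ fun _ => MvPolynomial.restrictTotalDegree (Fin 3) ℝ (k + 1)) ⊓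
    (H10 Ω).comap M.glueS

/-- `V` is a reduced Nedelec space: `W_h = ∇S_h ⊕ V`, and the splitting is stable. -/
structure IsReducedNedelec [Fintype ι] (M : TetMesh ι Ω) (k : ℕ)
    (V : Submodule ℝ (ι → VPoly)) : Prop where
  sup_eq : (M.lagrange k).map (brokenGrad ι) ⊔ V = M.nedelec k
  disjoint : Disjoint ((M.lagrange k).map (brokenGrad ι)) V
  stable : ∃ C : ℝ, 0 < C ∧ ∀ v ∈ V, M.hCurlNorm v ≤ C * M.l2Norm (brokenCurl v)

/-- The source field is in `H(curl; Ω) ∩ H²(𝒯_h)³`. -/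
def IsSourceField (M : TetMesh ι Ω) (hs : E3 → E3) : Prop :=
  MemHCurl Ω hs ∧ ∀ T i, MemH (interior (M.elem T)) 2 (fun x => hs x i)

open Classical in
/-- The continuous representative of `f` on each closed element. For a field in `H²(𝒯_h)³` it
exists by the Sobolev embedding; since an element is the closure of its interior, it is unique
there. (Without a continuous representative, `f` itself is used.) -/
def contRep (M : TetMesh ι Ω) (f : E3 → E3) (T : ι) : E3 → E3 :=
  if h : ∃ g : E3 → E3, ContinuousOn g (M.elem T) ∧ f =ᵐ[volume.restrict (M.elem T)] g
  then h.choose else f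

/-- The discrete energy `⟨w(curl a), 1⟩_h - ⟨h_s, curl a⟩_h`. -/
def energy [Fintype ι] (M : TetMesh ι Ω) {ℓ : ℕ} (Q : QuadRule ℓ) (w : E3 → E3 → ℝ)
    (hs : E3 → E3) (a : ι → VPoly) : ℝ :=
  M.quadInner Q (fun T x => w x (curlFun a T x)) (fun _ _ => (1 : ℝ)) -
    M.quadInner Q (M.contRep hs) (curlFun a)

end TetMesh

end Magnetostatics

end

open Magnetostatics

open MeasureTheory Set Filter Topology

namespace Magnetostatics

/-! The energy sees `a` only through the values of its curl at finitely many quadrature points. As a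
function `G` of these values it is a sum, with positive weights, of the functions `w x` at the nodes
minus linear terms. Each `w x` has Hessian at least `γ`, so `G` lies above its tangent paraboloids
(`add_fderiv_add_sq_le`). Convexity and coercivity then give existence, uniqueness and the
variational characterization (`existsUnique_isMinOn_comp_linearMap`), provided that a field in `V`
is determined by the nodal values of its curl.

This injectivity is `eq_zero_of_nodalCurl_eq_zero`. Curls of Nédélec fields are piecewise in `P_k`,
so exactness of the quadrature turns vanishing nodal values into a vanishing `L²` norm of the curl;
stability of the splitting then forces the field to be zero. -/

/-! ### Strongly convex functions -/

/-- A `C²` function whose Hessian is bounded below by `γ` lies above its tangent paraboloids. -/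
lemma add_fderiv_add_sq_le {F : Type*} [NormedAddCommGroup F] [NormedSpace ℝ F] {f : F → ℝ}
    (hf : ContDiff ℝ 2 f) {γ : ℝ} (hγ : ∀ ξ η : F, γ * ‖ξ‖ ^ 2 ≤ fderiv ℝ (fderiv ℝ f) η ξ ξ)
    (a b : F) : f a + fderiv ℝ f a (b - a) + γ / 2 * ‖b - a‖ ^ 2 ≤ f b := by
  set d := b - a with hd
  have hline : ∀ t : ℝ, HasDerivAt (fun t : ℝ => a + t • d) d t := fun t => by
    simpa using ((hasDerivAt_id t).smul_const d).const_add a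
  have hdf : Differentiable ℝ f := hf.differentiable (by norm_num)
  have hdf' : Differentiable ℝ (fderiv ℝ f) :=
    (hf.fderiv_right (m := 1) (by norm_num)).differentiable (by norm_num)
  have h1 : ∀ t : ℝ, HasDerivAt (fun t : ℝ => f (a + t • d)) (fderiv ℝ f (a + t • d) d) t :=
    fun t => (hdf _).hasFDerivAt.comp_hasDerivAt t (hline t)
  have h2 : ∀ t : ℝ, HasDerivAt (fun t : ℝ => fderiv ℝ f (a + t • d) d)
      (fderiv ℝ (fderiv ℝ f) (a + t • d) d d) t := fun t => by
    have h := HasFDerivAt.comp_hasDerivAt t (hdf' (a + t • d)).hasFDerivAt (hline t)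
    exact (ContinuousLinearMap.apply ℝ ℝ d).hasFDerivAt.comp_hasDerivAt t h
  -- The Hessian bound, integrated once along the ray from `a` through `b`.
  have h3 : ∀ t : ℝ, 0 ≤ t → γ * ‖d‖ ^ 2 * t ≤ fderiv ℝ f (a + t • d) d - fderiv ℝ f a d := by
    intro t ht
    have := mul_sub_le_image_sub_of_le_deriv (f := fun t : ℝ => fderiv ℝ f (a + t • d) d)
      (fun t => (h2 t).differentiableAt) (C := γ * ‖d‖ ^ 2)
      (fun t => by rw [(h2 t).deriv]; exact hγ _ _) ht
    simpa using this
  -- The gap between `f` on the ray and its tangent parabola. By `h3` it is nondecreasing for `t ≥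
  -- 0`, and the claim is `g 0 ≤ g 1`.
  let g : ℝ → ℝ := fun t => f (a + t • d) - t * fderiv ℝ f a d - γ / 2 * ‖d‖ ^ 2 * t ^ 2
  have hg : ∀ t, HasDerivAt g
      (fderiv ℝ f (a + t • d) d - fderiv ℝ f a d - γ * ‖d‖ ^ 2 * t) t := fun t => by
    have := ((h1 t).sub ((hasDerivAt_id t).mul_const (fderiv ℝ f a d))).sub
      (((hasDerivAt_id t).pow 2).const_mul (γ / 2 * ‖d‖ ^ 2))
    refine this.congr_deriv ?_
    simp
    ring
  have hmono : MonotoneOn g (Ici 0) := by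
    refine monotoneOn_of_deriv_nonneg (convex_Ici 0)
      (fun t _ => (hg t).continuousAt.continuousWithinAt)
      (fun t _ => (hg t).differentiableAt.differentiableWithinAt) fun t ht => ?_
    rw [interior_Ici] at ht
    rw [(hg t).deriv]
    linarith [h3 t (le_of_lt ht)]
  have := hmono (mem_Ici.2 le_rfl) (mem_Ici.2 zero_le_one) zero_le_one
  simp only [g, zero_smul, one_smul, add_zero, zero_mul, one_mul, hd, add_sub_cancel] at this
  linarith

/-- The composition of a strongly convex differentiable function with an injective linear map
into a finite-dimensional space has a unique minimizer, characterized by the vanishing of the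
first variation. -/
theorem existsUnique_isMinOn_comp_linearMap {E F : Type*} [AddCommGroup E] [Module ℝ E]
    [NormedAddCommGroup F] [NormedSpace ℝ F] [FiniteDimensional ℝ F] (Φ : E →ₗ[ℝ] F)
    (V : Submodule ℝ E) (hΦ : ∀ v ∈ V, Φ v = 0 → v = 0) {G : F → ℝ} {D : F → F →L[ℝ] ℝ}
    (hD : ∀ y, HasFDerivAt G (D y) y) {c : ℝ} (hc : 0 < c)
    (hG : ∀ y z, G y + D y (z - y) + c * ‖z - y‖ ^ 2 ≤ G z) :
    (∃! a, a ∈ V ∧ IsMinOn (fun v => G (Φ v)) V a) ∧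
      ∀ a ∈ V, IsMinOn (fun v => G (Φ v)) V a ↔ ∀ v ∈ V, D (Φ a) (Φ v) = 0 := by
  have hfst : ∀ a ∈ V, IsMinOn (fun v => G (Φ v)) V a → ∀ v ∈ V, D (Φ a) (Φ v) = 0 := by
    intro a ha hmin v hv
    have hline : HasDerivAt (fun t : ℝ => Φ a + t • Φ v) (Φ v) 0 := by
      simpa using ((hasDerivAt_id (0 : ℝ)).smul_const (Φ v)).const_add (Φ a)
    have hder : HasDerivAt (fun t : ℝ => G (Φ a + t • Φ v)) (D (Φ a) (Φ v)) 0 :=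
      HasFDerivAt.comp_hasDerivAt (0 : ℝ) (by simpa using hD (Φ a)) hline
    refine IsLocalMin.hasDerivAt_eq_zero (Eventually.of_forall fun t => ?_) hder
    have := hmin (V.add_mem ha (V.smul_mem t hv))
    simpa using this
  -- At a critical point the linear term of the paraboloid drops out. The remaining quadratic growth
  -- yields both minimality and uniqueness.
  have hsnd : ∀ a ∈ V, (∀ v ∈ V, D (Φ a) (Φ v) = 0) → ∀ b ∈ V,
      G (Φ a) + c * ‖Φ b - Φ a‖ ^ 2 ≤ G (Φ b) := by
    intro a ha h b hb
    have := hG (Φ a) (Φ b)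
    rwa [← map_sub, h _ (V.sub_mem hb ha), add_zero, map_sub] at this
  refine ⟨?_, fun a ha => ⟨hfst a ha, fun h b hb => ?_⟩⟩
  -- `E` carries no topology, so `G` is minimized over the image of `V`, a closed subspace of the
  -- finite-dimensional `F`.
  · obtain ⟨_, ⟨a, ha, rfl⟩, hmin⟩ : ∃ y ∈ (V.map Φ : Set F), IsMinOn G (V.map Φ : Set F) y := by
      refine ContinuousOn.exists_isMinOn' (fun y _ => (hD y).continuousAt.continuousWithinAt)
        (Submodule.closed_of_finiteDimensional _) (Submodule.zero_mem _) ?_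
      refine Eventually.filter_mono inf_le_left ?_
      -- Beyond this radius `c * ‖z‖ ^ 2` dominates `‖D 0‖ * ‖z‖`, hence `G 0 ≤ G z`.
      filter_upwards [(tendsto_norm_cocompact_atTop (E := F)).eventually_ge_atTop (‖D 0‖ / c)]
        with z hz
      have h1 := hG 0 z
      have h2 := (D 0).le_opNorm z
      rw [Real.norm_eq_abs] at h2
      have h3 := neg_abs_le (D 0 z)
      rw [div_le_iff₀ hc] at hz
      rw [sub_zero] at h1
      nlinarith [norm_nonneg z, mul_le_mul_of_nonneg_right hz (norm_nonneg z)]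
    have ha' : IsMinOn (fun v => G (Φ v)) V a := fun b hb => hmin (mem_image_of_mem Φ hb)
    refine ⟨a, ⟨ha, ha'⟩, fun b ⟨hb, hb'⟩ => ?_⟩
    have h1 := hsnd a ha (hfst a ha ha') b hb
    have h2 : G (Φ b) ≤ G (Φ a) := hb' ha
    have h3 : ‖Φ b - Φ a‖ ^ 2 ≤ 0 := by nlinarith
    have h4 : Φ (b - a) = 0 := by
      rw [map_sub]
      exact norm_eq_zero.1 (pow_eq_zero_iff two_ne_zero |>.1 (le_antisymm h3 (sq_nonneg _)))
    exact sub_eq_zero.1 (hΦ _ (V.sub_mem hb ha) h4)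
  · have := hsnd a ha h b hb
    have : 0 ≤ c * ‖Φ b - Φ a‖ ^ 2 := by positivity
    change G (Φ a) ≤ G (Φ b)
    linarith

/-! ### Polynomials -/

lemma pderiv_mem_restrictTotalDegree {k : ℕ} {p : SPoly}
    (hp : p ∈ MvPolynomial.restrictTotalDegree (Fin 3) ℝ (k + 1)) (i : Fin 3) :
    MvPolynomial.pderiv i p ∈ MvPolynomial.restrictTotalDegree (Fin 3) ℝ k := by
  rw [MvPolynomial.mem_restrictTotalDegree] at hp
  rw [p.as_sum, map_sum]
  refine Submodule.sum_mem _ fun s hs => ?_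
  rw [MvPolynomial.pderiv_monomial]
  -- Here the exponent subtraction would truncate, but the factor `s i` kills the monomial.
  by_cases hsi : s i = 0
  · simp [hsi]
  rw [MvPolynomial.mem_restrictTotalDegree]
  refine (MvPolynomial.totalDegree_monomial_le _ _).trans ?_
  have h1 : s.degree ≤ k + 1 := (MvPolynomial.le_totalDegree hs).trans hp
  have h2 : (s - Finsupp.single i 1).degree + 1 = s.degree := by
    have h3 : s - Finsupp.single i 1 + Finsupp.single i 1 = s :=
      tsub_add_cancel_of_le (Finsupp.single_le_iff.2 (Nat.one_le_iff_ne_zero.2 hsi))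
    conv_rhs => rw [← h3, map_add, Finsupp.degree_single]
  change (s - Finsupp.single i 1).degree ≤ k
  omega

lemma mem_polyVec {k : ℕ} {p : VPoly} :
    p ∈ polyVec k ↔ ∀ i, p i ∈ MvPolynomial.restrictTotalDegree (Fin 3) ℝ k := by
  simp [polyVec]

lemma curl_mem_polyVec {k : ℕ} {p : VPoly} (hp : p ∈ polyVec (k + 1)) : p.curl ∈ polyVec k := by
  rw [mem_polyVec] at hp ⊢
  have h := fun i j => pderiv_mem_restrictTotalDegree (hp j) i
  intro i
  fin_cases i
  · exact Submodule.sub_mem _ (h 1 2) (h 2 1)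
  · exact Submodule.sub_mem _ (h 2 0) (h 0 2)
  · exact Submodule.sub_mem _ (h 0 1) (h 1 0)

/-- Multiplication by `x` raises the degree by one. This loss is recovered by the curl, which lands
in `P_k`, where the quadrature is exact. -/
lemma nedelecLocal_le_polyVec (k : ℕ) : nedelecLocal k ≤ polyVec (k + 1) := by
  refine sup_le (fun p hp => ?_) ?_
  · rw [mem_polyVec] at hp ⊢
    intro i
    have := hp i
    rw [MvPolynomial.mem_restrictTotalDegree] at this ⊢
    omega
  · rintro _ ⟨q, hq, rfl⟩
    have hX : ∀ i j, MvPolynomial.X i * q j ∈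
        MvPolynomial.restrictTotalDegree (Fin 3) ℝ (k + 1) := by
      intro i j
      rw [MvPolynomial.mem_restrictTotalDegree]
      refine (MvPolynomial.totalDegree_mul _ _).trans ?_
      have hj : (q j).IsHomogeneous k := by
        simpa using (Submodule.mem_pi.1 hq) j (mem_univ j)
      rw [MvPolynomial.totalDegree_X, add_comm]
      gcongr
      exact hj.totalDegree_le
    rw [mem_polyVec]
    intro i
    fin_cases i
    · simpa [crossProduct] using Submodule.sub_mem _ (hX 1 2) (hX 2 1)
    · simpa [crossProduct] using Submodule.sub_mem _ (hX 2 0) (hX 0 2)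
    · simpa [crossProduct] using Submodule.sub_mem _ (hX 0 1) (hX 1 0)

lemma SPoly.continuous_toFun (p : SPoly) : Continuous p.toFun := by
  unfold SPoly.toFun
  exact (MvPolynomial.continuous_eval p).comp (by fun_prop)

lemma VPoly.continuous_toFun (p : VPoly) : Continuous p.toFun := by
  unfold VPoly.toFun
  exact (PiLp.continuous_toLp 2 _).comp (continuous_pi fun i => (p i).continuous_toFun)

/-- An open set contains a box, and a polynomial that vanishes on a product of infinite sets is
zero. Sup-norm balls provide the box. -/
lemma SPoly.eq_zero_of_eqOn_open {p : SPoly} {U : Set E3} (hU : IsOpen U) (hne : U.Nonempty)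
    (h : ∀ x ∈ U, p.toFun x = 0) : p = 0 := by
  obtain ⟨x, hx⟩ := hne
  have hV : IsOpen (WithLp.toLp 2 ⁻¹' U : Set (Fin 3 → ℝ)) :=
    hU.preimage (PiLp.continuous_toLp 2 _)
  obtain ⟨ε, hε, hball⟩ := Metric.isOpen_iff.1 hV (WithLp.ofLp x) hx
  refine MvPolynomial.funext_set (fun i => Metric.ball (x i) ε) (fun i => ?_) fun y hy => ?_
  · rw [Real.ball_eq_Ioo]
    exact Ioo_infinite (by linarith)
  · rw [map_zero]
    rw [← ball_pi _ hε] at hy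
    exact h (WithLp.toLp 2 y) (hball hy)

lemma VPoly.eq_zero_of_eqOn_open {p : VPoly} {U : Set E3} (hU : IsOpen U) (hne : U.Nonempty)
    (h : ∀ x ∈ U, p.toFun x = 0) : p = 0 := by
  funext i
  refine SPoly.eq_zero_of_eqOn_open hU hne fun x hx => ?_
  simpa [VPoly.toFun] using congrArg (fun y : E3 => y i) (h x hx)

/-- The value at `x` of the curl of a polynomial vector field, as a linear map. -/
noncomputable def curlEval (x : E3) : VPoly →ₗ[ℝ] E3 where
  toFun p := p.curl.toFun x
  map_add' p q := by
    ext i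
    fin_cases i <;> simp [VPoly.toFun, VPoly.curl, SPoly.toFun] <;> ring
  map_smul' c p := by
    ext i
    fin_cases i <;> simp [VPoly.toFun, VPoly.curl, SPoly.toFun] <;> ring

namespace TetMesh

variable {ι : Type*} {Ω : Set E3}

/-! ### Geometry of the mesh -/

lemma elem_subset_closure (M : TetMesh ι Ω) (T : ι) : M.elem T ⊆ closure Ω := by
  rw [← M.cover]
  exact subset_iUnion (fun T => convexHull ℝ (range (M.vert T))) T

/-- The numbers `1 - ∑ i, x i` and `x i` are the barycentric coordinates of the image point, and
they are nonnegative on the reference tetrahedron. -/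
lemma refMap_node_mem (M : TetMesh ι Ω) {ℓ : ℕ} (Q : QuadRule ℓ) (T : ι) (j : Fin ℓ) :
    M.refMap T (Q.node j) ∈ M.elem T := by
  obtain ⟨h0, h1⟩ := Q.node_mem j
  set x := Q.node j
  have hmem : ∀ i, M.vert T i ∈ M.elem T := fun i => subset_convexHull ℝ _ (mem_range_self i)
  have key := (convex_convexHull ℝ (range (M.vert T))).sum_mem (t := Finset.univ)
    (w := Fin.cons (1 - ∑ i, x i) (fun i => x i)) (z := M.vert T)
    (fun i _ => by
      refine Fin.cases ?_ (fun i => ?_) i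
      · simpa using h1
      · simpa using h0 i)
    (by rw [Fin.sum_univ_succ]; simp) (fun i _ => hmem i)
  change M.refMap T x ∈ convexHull ℝ (range (M.vert T))
  convert key using 1
  rw [Fin.sum_univ_succ]
  simp only [Fin.cons_zero, Fin.cons_succ, refMap, smul_sub, Finset.sum_sub_distrib, sub_smul,
    one_smul, Finset.sum_smul]
  abel

lemma interior_elem_nonempty (M : TetMesh ι Ω) (T : ι) : (interior (M.elem T)).Nonempty := by
  rw [elem, interior_convexHull_nonempty_iff_affineSpan_eq_top,
    (M.affineIndependent T).affineSpan_eq_top_iff_card_eq_finrank_add_one]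
  simp

lemma volume_elem_pos (M : TetMesh ι Ω) (T : ι) : 0 < volume.real (M.elem T) := by
  have hfin : (range (M.vert T)).Finite := finite_range _
  refine ENNReal.toReal_pos (Measure.measure_pos_of_nonempty_interior _ (M.interior_elem_nonempty T)).ne' ?_
  exact ((isBounded_convexHull).2 hfin.isBounded).measure_lt_top.ne

/-- Distinct elements have distinct vertex sets of equal size, so some vertex of `T` is not shared.
By conformity the intersection is the hull of the shared vertices; by affine independence these do
not span the space, so the hull has empty interior. -/
lemma disjoint_interior_elem (M : TetMesh ι Ω) {T T' : ι} (h : T ≠ T') :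
    Disjoint (interior (M.elem T)) (interior (M.elem T')) := by
  obtain ⟨i, hi⟩ : ∃ i, M.vert T i ∉ range (M.vert T') := by
    by_contra! hcon
    have hsub : range (M.vert T) ⊆ range (M.vert T') := range_subset_iff.2 hcon
    refine h (M.injective (eq_of_subset_of_ncard_le hsub ?_ (finite_range _)))
    rw [ncard_range_of_injective (M.affineIndependent T).injective,
      ncard_range_of_injective (M.affineIndependent T').injective]
  rw [disjoint_iff_inter_eq_empty, ← interior_inter, elem, elem, M.conforming]
  by_contra hne
  rw [← ne_eq, ← nonempty_iff_ne_empty, interior_convexHull_nonempty_iff_affineSpan_eq_top,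
    inter_comm, ← image_preimage_eq_inter_range] at hne
  refine hi (((M.affineIndependent T).mem_affineSpan_iff i (M.vert T ⁻¹' range (M.vert T'))).1 ?_)
  rw [hne]
  exact AffineSubspace.mem_top ℝ E3 _

lemma glueV_apply_of_mem [Fintype ι] (M : TetMesh ι Ω) (u : ι → VPoly) {T : ι} {x : E3}
    (hx : x ∈ interior (M.elem T)) : M.glueV u x = (u T).toFun x := by
  change ∑ T', (interior (M.elem T')).indicator (u T').toFun x = _
  rw [Finset.sum_eq_single T (fun T' _ hT' => ?_) (by simp), indicator_of_mem hx]
  exact indicator_of_notMem (disjoint_left.1 (M.disjoint_interior_elem hT'.symm) hx) _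

/-- A piecewise polynomial field that vanishes almost everywhere vanishes identically. -/
lemma eq_zero_of_glueV_ae_eq_zero [Fintype ι] (M : TetMesh ι Ω) (hΩ : IsOpen Ω) {u : ι → VPoly}
    (hu : M.glueV u =ᵐ[volume.restrict Ω] 0) : u = 0 := by
  funext T
  -- Elements are only known to lie in `closure Ω`, so the argument runs on the part inside `Ω`,
  -- which is nonempty by density.
  have hU : IsOpen (interior (M.elem T) ∩ Ω) := isOpen_interior.inter hΩ
  have hne : (interior (M.elem T) ∩ Ω).Nonempty := by
    obtain ⟨x, hx⟩ := M.interior_elem_nonempty T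
    exact mem_closure_iff.1 (M.elem_subset_closure T (interior_subset hx)) _ isOpen_interior hx
  refine VPoly.eq_zero_of_eqOn_open hU hne ?_
  have hae : (u T).toFun =ᵐ[volume.restrict (interior (M.elem T) ∩ Ω)] 0 := by
    filter_upwards [ae_restrict_of_ae_restrict_of_subset inter_subset_right hu,
      ae_restrict_mem hU.measurableSet] with x hx hxU
    rw [← M.glueV_apply_of_mem u hxU.1, hx]
  exact Measure.eqOn_open_of_ae_eq hae hU (VPoly.continuous_toFun _).continuousOn
    continuousOn_const

/-! ### The discrete energy -/

/-- The nodal values of the curl of a piecewise polynomial field. -/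
noncomputable def nodalCurl (M : TetMesh ι Ω) {ℓ : ℕ} (Q : QuadRule ℓ) :
    (ι → VPoly) →ₗ[ℝ] (ι × Fin ℓ → E3) :=
  LinearMap.pi fun q => curlEval (M.refMap q.1 (Q.node q.2)) ∘ₗ LinearMap.proj q.1

lemma nodalCurl_apply (M : TetMesh ι Ω) {ℓ : ℕ} (Q : QuadRule ℓ) (u : ι → VPoly)
    (q : ι × Fin ℓ) : M.nodalCurl Q u q = curlFun u q.1 (M.refMap q.1 (Q.node q.2)) := rfl

lemma quadInner_eq_sum_prod [Fintype ι] {F : Type*} [NormedAddCommGroup F]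
    [InnerProductSpace ℝ F] (M : TetMesh ι Ω) {ℓ : ℕ} (Q : QuadRule ℓ) (f g : ι → E3 → F) :
    M.quadInner Q f g = ∑ q : ι × Fin ℓ, Q.weight q.2 * volume.real (M.elem q.1) *
      inner ℝ (f q.1 (M.refMap q.1 (Q.node q.2))) (g q.1 (M.refMap q.1 (Q.node q.2))) := by
  rw [quadInner, Fintype.sum_prod_type]
  refine Finset.sum_congr rfl fun T _ => Finset.sum_congr rfl fun j _ => ?_
  ring

/-- A field of the reduced Nédélec space is determined by the nodal values of its curl. -/
lemma eq_zero_of_nodalCurl_eq_zero [Fintype ι] (M : TetMesh ι Ω) (hΩ : IsOpen Ω) {k ℓ : ℕ}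
    {Q : QuadRule ℓ} (hQ : M.QuadExact Q k) {V : Submodule ℝ (ι → VPoly)}
    (hV : M.IsReducedNedelec k V) {v : ι → VPoly} (hv : v ∈ V) (h : M.nodalCurl Q v = 0) :
    v = 0 := by
  have hvW : v ∈ M.nedelec k := hV.sup_eq ▸ Submodule.mem_sup_right hv
  obtain ⟨hloc, hL2, -⟩ := hvW
  have hcurl : ∀ T, brokenCurl v T ∈ polyVec k := fun T =>
    curl_mem_polyVec (nedelecLocal_le_polyVec k (Submodule.mem_pi.1 hloc T (mem_univ T)))
  have hcurl0 : M.l2Norm (brokenCurl v) = 0 := by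
    -- Exactness is applied to the curl paired with itself: the quadrature sum vanishes term by
    -- term.
    have hex := hQ _ _ hcurl hcurl
    rw [quadInner_eq_sum_prod, Finset.sum_eq_zero] at hex
    · simp only [real_inner_self_eq_norm_sq] at hex
      rw [l2Norm, ← hex, Real.sqrt_zero]
    · intro q _
      have hq : (brokenCurl v q.1).toFun (M.refMap q.1 (Q.node q.2)) = 0 := congrFun h q
      rw [hq, inner_zero_left, mul_zero]
  obtain ⟨C, -, hC⟩ := hV.stable
  have hle := hC v hv
  rw [hcurl0, mul_zero, hCurlNorm, hcurl0] at hle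
  have hsq : M.l2Norm v ^ 2 = 0 := by
    have := Real.sqrt_eq_zero'.1 (le_antisymm hle (Real.sqrt_nonneg _))
    nlinarith [sq_nonneg (M.l2Norm v)]
  have hint : ∫ x in Ω, ‖M.glueV v x‖ ^ 2 = 0 := by
    rwa [l2Norm, Real.sq_sqrt (integral_nonneg fun x => sq_nonneg _)] at hsq
  -- Square integrability of `v` is essential: the integral of a nonintegrable function is zero by
  -- convention.
  rw [integral_eq_zero_iff_of_nonneg (fun x => sq_nonneg _) hL2.norm.integrable_sq] at hint
  refine M.eq_zero_of_glueV_ae_eq_zero hΩ ?_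
  filter_upwards [hint] with x hx
  simpa using hx

end TetMesh

end Magnetostatics

/-! ### The discrete minimization problem -/

open Magnetostatics
theorem theorem2 {ι : Type*} [Fintype ι] {Ω : Set E3} (hΩ : IsAdmissibleDomain Ω)
    (w : E3 → E3 → ℝ) (hw : IsEnergyDensity Ω w)
    (M : TetMesh ι Ω) (σ : ℝ) (hσ : M.ShapeRegular σ)
    (k ℓ : ℕ) (Q : QuadRule ℓ) (hQ : M.QuadExact Q k)
    (V : Submodule ℝ (ι → VPoly)) (hV : M.IsReducedNedelec k V)
    (hs : E3 → E3) (hhs : M.IsSourceField hs) :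
    (∃! a : ι → VPoly, a ∈ V ∧ IsMinOn (M.energy Q w hs) V a) ∧
    ∀ a ∈ V, IsMinOn (M.energy Q w hs) V a ↔
      ∀ v ∈ V,
        M.quadInner Q (fun T x => gradient (w x) (TetMesh.curlFun a T x)) (TetMesh.curlFun v) =
          M.quadInner Q (M.contRep hs) (TetMesh.curlFun v) := by
  obtain ⟨γ, L, hγ, -, hell⟩ := hw.elliptic
  let x : ι × Fin ℓ → E3 := fun q => M.refMap q.1 (Q.node q.2)
  have hx : ∀ q, x q ∈ closure Ω := fun q =>
    M.elem_subset_closure q.1 (M.refMap_node_mem Q q.1 q.2)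
  let m : ι × Fin ℓ → ℝ := fun q => Q.weight q.2 * volume.real (M.elem q.1)
  have hm : ∀ q, 0 < m q := fun q => mul_pos (Q.weight_pos q.2) (M.volume_elem_pos q.1)
  let b : ι × Fin ℓ → E3 := fun q => M.contRep hs q.1 (x q)
  let G : (ι × Fin ℓ → E3) → ℝ := fun y => ∑ q, m q * (w (x q) (y q) - inner ℝ (b q) (y q))
  let D : (ι × Fin ℓ → E3) → (ι × Fin ℓ → E3) →L[ℝ] ℝ := fun y =>
    ∑ q, m q • ((fderiv ℝ (w (x q)) (y q) - innerSL ℝ (b q)).comp (ContinuousLinearMap.proj q))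
  have hDapply : ∀ y z, D y z =
      ∑ q, m q * (fderiv ℝ (w (x q)) (y q) (z q) - inner ℝ (b q) (z q)) := by
    intro y z
    simp [D]
  have hdiff : ∀ q, Differentiable ℝ (w (x q)) := fun q =>
    (hw.contDiff _ (hx q)).differentiable (by norm_num)
  have hD : ∀ y, HasFDerivAt G (D y) y := by
    intro y
    refine HasFDerivAt.fun_sum fun q _ => HasFDerivAt.const_mul ?_ _
    exact HasFDerivAt.comp y
      (((hdiff q) (y q)).hasFDerivAt.sub (innerSL ℝ (b q)).hasFDerivAt)
      (ContinuousLinearMap.proj (R := ℝ) (φ := fun _ : ι × Fin ℓ => E3) q).hasFDerivAt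
  -- The smallest nodal weight; without any nodes every positive constant serves.
  obtain ⟨c, hc, hcm⟩ : ∃ c > 0, ∀ q, c ≤ m q := by
    rcases isEmpty_or_nonempty (ι × Fin ℓ) with _ | _
    · exact ⟨1, one_pos, fun q => isEmptyElim q⟩
    · obtain ⟨q, hq⟩ := Finite.exists_min m
      exact ⟨m q, hm q, hq⟩
  -- The product carries the sup norm, whereas the convexity estimates add up squares.
  have hnorm : ∀ y : ι × Fin ℓ → E3, ‖y‖ ^ 2 ≤ ∑ q, ‖y q‖ ^ 2 := by
    intro y
    have : ‖y‖ ≤ √(∑ q, ‖y q‖ ^ 2) := by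
      refine (pi_norm_le_iff_of_nonneg (Real.sqrt_nonneg _)).2 fun q => Real.le_sqrt_of_sq_le ?_
      exact Finset.single_le_sum (f := fun q => ‖y q‖ ^ 2) (fun _ _ => sq_nonneg _)
        (Finset.mem_univ q)
    exact (Real.le_sqrt (norm_nonneg y) (Finset.sum_nonneg fun _ _ => sq_nonneg _)).1 this
  have hG : ∀ y z, G y + D y (z - y) + c * (γ / 2) * ‖z - y‖ ^ 2 ≤ G z := by
    intro y z
    have h1 : c * (γ / 2) * ‖z - y‖ ^ 2 ≤ ∑ q, m q * (γ / 2 * ‖z q - y q‖ ^ 2) := by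
      refine (mul_le_mul_of_nonneg_left (hnorm (z - y)) (by positivity)).trans ?_
      rw [Finset.mul_sum]
      refine Finset.sum_le_sum fun q _ => ?_
      rw [mul_assoc]
      exact mul_le_mul_of_nonneg_right (hcm q) (by positivity)
    refine (add_le_add_right h1 _).trans ?_
    rw [hDapply, ← Finset.sum_add_distrib, ← Finset.sum_add_distrib]
    refine Finset.sum_le_sum fun q _ => ?_
    have h2 := add_fderiv_add_sq_le (hw.contDiff _ (hx q))
      (fun ξ η => (hell _ (hx q) ξ η).1) (y q) (z q)
    rw [← mul_add, ← mul_add]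
    refine mul_le_mul_of_nonneg_left ?_ (hm q).le
    rw [Pi.sub_apply, inner_sub_right]
    linarith
  have hE : M.energy Q w hs = fun a => G (M.nodalCurl Q a) := by
    funext a
    rw [TetMesh.energy, TetMesh.quadInner_eq_sum_prod, TetMesh.quadInner_eq_sum_prod,
      ← Finset.sum_sub_distrib]
    refine Finset.sum_congr rfl fun q _ => ?_
    simp only [TetMesh.nodalCurl_apply, m, b, x, mul_sub]
    simp
  -- The gradient is the Riesz representative of the derivative, so the first variation of `G` is
  -- the difference of the two sides of the discrete equation.
  have hchar : ∀ a v, D (M.nodalCurl Q a) (M.nodalCurl Q v) = 0 ↔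
      M.quadInner Q (fun T x => gradient (w x) (TetMesh.curlFun a T x)) (TetMesh.curlFun v) =
        M.quadInner Q (M.contRep hs) (TetMesh.curlFun v) := by
    intro a v
    rw [← sub_eq_zero (a := M.quadInner Q _ _), TetMesh.quadInner_eq_sum_prod,
      TetMesh.quadInner_eq_sum_prod, ← Finset.sum_sub_distrib, hDapply]
    simp only [TetMesh.nodalCurl_apply, m, b, x, mul_sub, ← toDual_gradient,
      InnerProductSpace.toDual_apply_apply]
  rw [hE]
  obtain ⟨h1, h2⟩ := existsUnique_isMinOn_comp_linearMap (M.nodalCurl Q) V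
    (fun v hv => M.eq_zero_of_nodalCurl_eq_zero hΩ.isOpen hQ hV hv) hD
    (c := c * (γ / 2)) (by positivity) hG
  exact ⟨h1, fun a ha => (h2 a ha).trans (forall₂_congr fun v _ => hchar a v)⟩
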